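/- Let $\ell,d>0$, let $Y=(0,\ell)\times(0,d)$ be the unit cell, and let $G,\rho\in L^\infty(Y)$ be real-valued with $G_{\inf}\le G\le G_{\sup}$ and $\rho_{\inf}\le\rho\le\rho_{\sup}$ a.e. on $Y$ for some positive constants $G_{\inf},G_{\sup},\rho_{\inf},\rho_{\sup}$. Let $H^1_p(Y)$ be the Hilbert space of all complex-valued $g\in L^2(Y)$ with weak gradient $\nabla g\in (L^2(Y))^2$ whose traces on opposite sides of $Y$ coincide, with inner product $\langle g,h\rangle=\int_Y g\,\overline h+\int_Y\nabla g\cdot\overline{\nabla h}$. Fix a frequency $\omega>0$ and a wavenumber $k_2\in\mathbb R$, and let $\mathcal A,\mathcal B,\mathcal C$ be the bounded operators on $H^1_p(Y)$ defined, for all $\phi,\psi\in H^1_p(Y)$, by $$\langle\mathcal A\phi,\psi\rangle = k_2^2\int_Y G\phi\overline\psi - k_2 i\int_Y G\Big(\frac{\partial\phi}{\partial\xi_2}\overline\psi-\phi\frac{\partial\overline\psi}{\partial\xi_2}\Big)-\omega^2\int_Y\rho\,\phi\overline\psi+\int_Y G\,\nabla\phi\cdot\nabla\overline\psi,$$ $$\langle\mathcal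 B\phi,\psi\rangle = -i\int_Y G\Big(\frac{\partial\phi}{\partial\xi_1}\overline\psi-\phi\frac{\partial\overline\psi}{\partial\xi_1}\Big),\qquad \langle\mathcal C\phi,\psi\rangle=\int_Y G\phi\overline\psi .$$ Put $\mathcal T(\lambda)=\mathcal A+\lambda\mathcal B+\lambda^2\mathcal C$ for $\lambda\in\mathbb C$. If $\mathcal T(\lambda)\phi=0$ for some non-zero $\phi\in H^1_p(Y)$, then there is a non-zero $\psi\in H^1_p(Y)$ with $\mathcal T(\overline\lambda)\psi=0$. Hence the eigenvalues of the quadratic eigenvalue problem come in complex-conjugate pairs: if $\kappa\in\mathbb C$ is an eigenvalue, i.e. there is a non-zero $\phi\in H^1_p(Y)$ such that for all $\psi\in H^1_p(Y)$ $$\kappa^2\int_Y G\phi\overline\psi-\kappa\, i\int_Y G\Big(\frac{\partial\phi}{\partial\xi_1}\overline\psi-\phi\frac{\partial\overline\psi}{\partial\xi_1}\Big)+\Big\{k_2^2\int_Y G\phi\overline\psi - k_2 i\int_Y G\Big(\frac{\partial\phi}{\partial\xi_2}\overline\psi-\phi\frac{\partial\overline\psi}{\partial\xi_2}\Big)-\omega^2\int_Y\rho\,\phi\overline\psi+\int_Y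 G\,\nabla\phi\cdot\nabla\overline\psi\Big\}=0,$$ then so is $\overline\kappa$, and conversely. -/

import Mathlib

open MeasureTheory Set
open scoped ENNReal ComplexConjugate

noncomputable section

/-- A two-dimensional medium on the rectangular unit cell `(0, ℓ) × (0, d)`: real coefficients
`G` and `ρ` in `L^∞` of the cell, bounded below and above by positive constants almost everywhere
on the cell.  Only the values of `G` and `ρ` on the cell matter. -/
structure PeriodicMedium where
  ℓ : ℝ
  d : ℝ
  ℓ_pos : 0 < ℓ
  d_pos : 0 < d
  G : ℝ × ℝ → ℝ
  ρ : ℝ × ℝ → ℝ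
  G_meas : AEStronglyMeasurable G (volume.restrict (Ioo 0 ℓ ×ˢ Ioo 0 d))
  ρ_meas : AEStronglyMeasurable ρ (volume.restrict (Ioo 0 ℓ ×ˢ Ioo 0 d))
  Ginf : ℝ
  Gsup : ℝ
  ρinf : ℝ
  ρsup : ℝ
  Ginf_pos : 0 < Ginf
  ρinf_pos : 0 < ρinf
  G_bound : ∀ᵐ ξ ∂(volume.restrict (Ioo 0 ℓ ×ˢ Ioo 0 d)), Ginf ≤ G ξ ∧ G ξ ≤ Gsup
  ρ_bound : ∀ᵐ ξ ∂(volume.restrict (Ioo 0 ℓ ×ˢ Ioo 0 d)), ρinf ≤ ρ ξ ∧ ρ ξ ≤ ρsup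

namespace PeriodicMedium

/-- The unit cell `Y = {0 < ξ₁ < ℓ, 0 < ξ₂ < d}`. -/
def Y (M : PeriodicMedium) : Set (ℝ × ℝ) := Ioo 0 M.ℓ ×ˢ Ioo 0 M.d

/-- The Hilbert space `L²(Y; ℂ)`. -/
abbrev L2Y (M : PeriodicMedium) : Type := Lp ℂ 2 (volume.restrict M.Y)

/-- `gₑ` is the weak derivative of `g` on `Y` in the direction `e`. -/
def HasWeakDeriv (M : PeriodicMedium) (e : ℝ × ℝ) (g gₑ : M.L2Y) : Prop :=
  ∀ η : ℝ × ℝ → ℂ, ContDiff ℝ (⊤ : ℕ∞) η → HasCompactSupport η → tsupport η ⊆ M.Y →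
    ∫ ξ in M.Y, g ξ * fderiv ℝ η ξ e = - ∫ ξ in M.Y, gₑ ξ * η ξ

/-- `g`, with weak derivative `g₁ = ∂g/∂ξ₁`, has the traces `t₀` on the side `ξ₁ = 0` and `t₁` on
the side `ξ₁ = ℓ` (traces of Sobolev functions, characterized by Green's formula against all
functions smooth up to the boundary). -/
def HasTracesFst (M : PeriodicMedium) (g g₁ : M.L2Y)
    (t₀ t₁ : Lp ℂ 2 (volume.restrict (Ioo 0 M.d))) : Prop :=
  ∀ η : ℝ × ℝ → ℂ, ContDiff ℝ (⊤ : ℕ∞) η →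
    ∫ ξ in M.Y, (g ξ * fderiv ℝ η ξ (1, 0) + g₁ ξ * η ξ) =
      ∫ y in Ioo 0 M.d, (t₁ y * η (M.ℓ, y) - t₀ y * η (0, y))

/-- `g`, with weak derivative `g₂ = ∂g/∂ξ₂`, has the traces `t₀` on the side `ξ₂ = 0` and `t₁` on
the side `ξ₂ = d`. -/
def HasTracesSnd (M : PeriodicMedium) (g g₂ : M.L2Y)
    (t₀ t₁ : Lp ℂ 2 (volume.restrict (Ioo 0 M.ℓ))) : Prop :=
  ∀ η : ℝ × ℝ → ℂ, ContDiff ℝ (⊤ : ℕ∞) η →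
    ∫ ξ in M.Y, (g ξ * fderiv ℝ η ξ (0, 1) + g₂ ξ * η ξ) =
      ∫ x in Ioo 0 M.ℓ, (t₁ x * η (x, M.d) - t₀ x * η (x, 0))

/-- `u = (g, g₁, g₂)` consists of a function `g ∈ L²(Y)` and its weak gradient
`(g₁, g₂) ∈ L²(Y)²`, and the traces of `g` on opposite sides of `Y` coincide. -/
def IsH1p (M : PeriodicMedium) (u : PiLp 2 (fun _ : Fin 3 => M.L2Y)) : Prop :=
  M.HasWeakDeriv (1, 0) (u 0) (u 1) ∧ M.HasWeakDeriv (0, 1) (u 0) (u 2) ∧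
  (∃ t, M.HasTracesFst (u 0) (u 1) t t) ∧ (∃ t, M.HasTracesSnd (u 0) (u 2) t t)

/-! ### Integrals against fixed square-integrable functions -/

/-- The functional `u ↦ ∫ u h`. -/
def pair {α : Type} [MeasurableSpace α] {μ : Measure α} {h : α → ℂ} (hh : MemLp h 2 μ) :
    Lp ℂ 2 μ →L[ℂ] ℂ :=
  ((ContinuousLinearMap.mul ℂ ℂ).lpPairing μ 2 2).flip (hh.toLp h)

lemma pair_apply {α : Type} [MeasurableSpace α] {μ : Measure α} {h : α → ℂ} (hh : MemLp h 2 μ)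
    (u : Lp ℂ 2 μ) : pair hh u = ∫ x, u x * h x ∂μ := by
  rw [pair, ContinuousLinearMap.flip_apply, ContinuousLinearMap.lpPairing_eq_integral]
  apply integral_congr_ae
  filter_upwards [hh.coeFn_toLp] with x hx
  simp [hx]

lemma integrable_mul {α : Type} [MeasurableSpace α] {μ : Measure α} {f h : α → ℂ}
    (hf : MemLp f 2 μ) (hh : MemLp h 2 μ) : Integrable (fun x => f x * h x) μ :=
  hf.integrable_mul hh

lemma memLp_compact {X : Type} [TopologicalSpace X] [MeasurableSpace X] [BorelSpace X]
    [SecondCountableTopology X] [T2Space X] {μ : Measure X} [IsFiniteMeasureOnCompacts μ]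
    {K : Set X} (hK : IsCompact K) {h : X → ℂ} (hh : Continuous h) :
    MemLp h 2 (μ.restrict K) := by
  obtain ⟨C, hC⟩ := hK.exists_bound_of_continuousOn hh.continuousOn
  have : IsFiniteMeasure (μ.restrict K) := ⟨by simpa using hK.measure_lt_top⟩
  refine MemLp.of_bound hh.aestronglyMeasurable C ?_
  exact (ae_restrict_iff' hK.measurableSet).2 (Filter.Eventually.of_forall hC)

lemma memLp_Y (M : PeriodicMedium) {h : ℝ × ℝ → ℂ} (hh : Continuous h) :
    MemLp h 2 (volume.restrict M.Y) :=
  (memLp_compact (K := Icc 0 M.ℓ ×ˢ Icc 0 M.d) (isCompact_Icc.prod isCompact_Icc) hh).mono_measure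
    (Measure.restrict_mono (prod_mono Ioo_subset_Icc_self Ioo_subset_Icc_self) le_rfl)

lemma memLp_Ioo {a : ℝ} {h : ℝ → ℂ} (hh : Continuous h) :
    MemLp h 2 (volume.restrict (Ioo 0 a)) :=
  (memLp_compact (K := Icc 0 a) isCompact_Icc hh).mono_measure
    (Measure.restrict_mono Ioo_subset_Icc_self le_rfl)

lemma cont_fderiv {η : ℝ × ℝ → ℂ} (hη : ContDiff ℝ (⊤ : ℕ∞) η) (e : ℝ × ℝ) :
    Continuous (fun ξ => fderiv ℝ η ξ e) :=
  (hη.continuous_fderiv (by simp)).clm_apply continuous_const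

/-! ### The periodic Sobolev space -/

lemma isH1p_add (M : PeriodicMedium) {u v : PiLp 2 (fun _ : Fin 3 => M.L2Y)}
    (hu : M.IsH1p u) (hv : M.IsH1p v) : M.IsH1p (u + v) := by
  have key : ∀ {α : Type} [MeasurableSpace α] {μ : Measure α} {h : α → ℂ} (hh : MemLp h 2 μ)
      (f g : Lp ℂ 2 μ), ∫ x, (f + g : Lp ℂ 2 μ) x * h x ∂μ
        = (∫ x, f x * h x ∂μ) + ∫ x, g x * h x ∂μ := by
    intro α _ μ h hh f g
    simp only [← pair_apply hh, map_add]
  have hm := fun {h : ℝ × ℝ → ℂ} (hh : Continuous h) => M.memLp_Y hh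
  obtain ⟨u1, u2, ⟨s, us⟩, ⟨t, ut⟩⟩ := hu
  obtain ⟨v1, v2, ⟨s', vs⟩, ⟨t', vt⟩⟩ := hv
  refine ⟨fun η h1 h2 h3 => ?_, fun η h1 h2 h3 => ?_, ⟨s + s', fun η h1 => ?_⟩,
    ⟨t + t', fun η h1 => ?_⟩⟩
  · simp only [PiLp.add_apply]
    rw [key (hm (cont_fderiv h1 _)), key (hm h1.continuous), u1 η h1 h2 h3, v1 η h1 h2 h3]
    ring
  · simp only [PiLp.add_apply]
    rw [key (hm (cont_fderiv h1 _)), key (hm h1.continuous), u2 η h1 h2 h3, v2 η h1 h2 h3]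
    ring
  · have a := us η h1
    have b := vs η h1
    have c1 : Continuous fun y : ℝ => η (M.ℓ, y) := h1.continuous.comp (by fun_prop)
    have c2 : Continuous fun y : ℝ => η (0, y) := h1.continuous.comp (by fun_prop)
    simp only [PiLp.add_apply]
    rw [integral_add (integrable_mul (Lp.memLp _) (hm (cont_fderiv h1 _)))
      (integrable_mul (Lp.memLp _) (hm h1.continuous)),
      integral_sub (integrable_mul (Lp.memLp _) (memLp_Ioo c1))
      (integrable_mul (Lp.memLp _) (memLp_Ioo c2))] at a b ⊢
    rw [key (hm (cont_fderiv h1 _)), key (hm h1.continuous), key (memLp_Ioo c1),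
      key (memLp_Ioo c2)]
    linear_combination a + b
  · have a := ut η h1
    have b := vt η h1
    have c1 : Continuous fun y : ℝ => η (y, M.d) := h1.continuous.comp (by fun_prop)
    have c2 : Continuous fun y : ℝ => η (y, 0) := h1.continuous.comp (by fun_prop)
    simp only [PiLp.add_apply]
    rw [integral_add (integrable_mul (Lp.memLp _) (hm (cont_fderiv h1 _)))
      (integrable_mul (Lp.memLp _) (hm h1.continuous)),
      integral_sub (integrable_mul (Lp.memLp _) (memLp_Ioo c1))
      (integrable_mul (Lp.memLp _) (memLp_Ioo c2))] at a b ⊢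
    rw [key (hm (cont_fderiv h1 _)), key (hm h1.continuous), key (memLp_Ioo c1),
      key (memLp_Ioo c2)]
    linear_combination a + b

lemma isH1p_smul (M : PeriodicMedium) (c : ℂ) {u : PiLp 2 (fun _ : Fin 3 => M.L2Y)}
    (hu : M.IsH1p u) : M.IsH1p (c • u) := by
  have key : ∀ {α : Type} [MeasurableSpace α] {μ : Measure α} {h : α → ℂ} (hh : MemLp h 2 μ)
      (f : Lp ℂ 2 μ), ∫ x, (c • f : Lp ℂ 2 μ) x * h x ∂μ = c * (∫ x, f x * h x ∂μ) := by
    intro α _ μ h hh f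
    simp only [← pair_apply hh, map_smul, smul_eq_mul]
  have hm := fun {h : ℝ × ℝ → ℂ} (hh : Continuous h) => M.memLp_Y hh
  obtain ⟨u1, u2, ⟨s, us⟩, ⟨t, ut⟩⟩ := hu
  refine ⟨fun η h1 h2 h3 => ?_, fun η h1 h2 h3 => ?_, ⟨c • s, fun η h1 => ?_⟩,
    ⟨c • t, fun η h1 => ?_⟩⟩
  · simp only [PiLp.smul_apply]
    rw [key (hm (cont_fderiv h1 _)), key (hm h1.continuous), u1 η h1 h2 h3]
    ring
  · simp only [PiLp.smul_apply]
    rw [key (hm (cont_fderiv h1 _)), key (hm h1.continuous), u2 η h1 h2 h3]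
    ring
  · have a := us η h1
    have c1 : Continuous fun y : ℝ => η (M.ℓ, y) := h1.continuous.comp (by fun_prop)
    have c2 : Continuous fun y : ℝ => η (0, y) := h1.continuous.comp (by fun_prop)
    simp only [PiLp.smul_apply]
    rw [integral_add (integrable_mul (Lp.memLp _) (hm (cont_fderiv h1 _)))
      (integrable_mul (Lp.memLp _) (hm h1.continuous)),
      integral_sub (integrable_mul (Lp.memLp _) (memLp_Ioo c1))
      (integrable_mul (Lp.memLp _) (memLp_Ioo c2))] at a ⊢
    rw [key (hm (cont_fderiv h1 _)), key (hm h1.continuous), key (memLp_Ioo c1),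
      key (memLp_Ioo c2)]
    linear_combination c * a
  · have a := ut η h1
    have c1 : Continuous fun y : ℝ => η (y, M.d) := h1.continuous.comp (by fun_prop)
    have c2 : Continuous fun y : ℝ => η (y, 0) := h1.continuous.comp (by fun_prop)
    simp only [PiLp.smul_apply]
    rw [integral_add (integrable_mul (Lp.memLp _) (hm (cont_fderiv h1 _)))
      (integrable_mul (Lp.memLp _) (hm h1.continuous)),
      integral_sub (integrable_mul (Lp.memLp _) (memLp_Ioo c1))
      (integrable_mul (Lp.memLp _) (memLp_Ioo c2))] at a ⊢
    rw [key (hm (cont_fderiv h1 _)), key (hm h1.continuous), key (memLp_Ioo c1),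
      key (memLp_Ioo c2)]
    linear_combination c * a

lemma isH1p_zero (M : PeriodicMedium) : M.IsH1p 0 := by
  have h0 : ∀ {α : Type} [MeasurableSpace α] {μ : Measure α} {h : α → ℂ},
      (fun x => (0 : Lp ℂ 2 μ) x * h x) =ᵐ[μ] 0 := by
    intro α _ μ h
    filter_upwards [Lp.coeFn_zero ℂ 2 μ] with x hx
    rw [hx]; simp
  have hz : ∀ {α : Type} [MeasurableSpace α] {μ : Measure α} {h : α → ℂ},
      ∫ x, (0 : Lp ℂ 2 μ) x * h x ∂μ = 0 := fun {α} _ {μ h} => by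
    rw [integral_congr_ae h0]; simp
  refine ⟨fun η h1 h2 h3 => ?_, fun η h1 h2 h3 => ?_, ⟨0, fun η h1 => ?_⟩, ⟨0, fun η h1 => ?_⟩⟩
  · simp only [PiLp.zero_apply, hz, neg_zero]
  · simp only [PiLp.zero_apply, hz, neg_zero]
  · simp only [PiLp.zero_apply, ← mul_add, ← mul_sub, hz]
  · simp only [PiLp.zero_apply, ← mul_add, ← mul_sub, hz]

/-- The periodic Sobolev space `H¹_p(Y)`.  A function is represented together with its (unique)
weak gradient as `(g, ∂g/∂ξ₁, ∂g/∂ξ₂)`, so that the inner product inherited from `L²(Y)³` is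
`(g, h)_{L²} + (∇g, ∇h)_{L²}`. -/
def H1p (M : PeriodicMedium) : Submodule ℂ (PiLp 2 (fun _ : Fin 3 => M.L2Y)) where
  carrier := {u | M.IsH1p u}
  add_mem' hu hv := M.isH1p_add hu hv
  zero_mem' := M.isH1p_zero
  smul_mem' c _ hu := M.isH1p_smul c hu

/-- The function `φ` itself. -/
def fn {M : PeriodicMedium} (φ : M.H1p) : ℝ × ℝ → ℂ := φ.1 0

/-- The weak partial derivative `∂φ/∂ξ₁`. -/
def d1 {M : PeriodicMedium} (φ : M.H1p) : ℝ × ℝ → ℂ := φ.1 1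

/-- The weak partial derivative `∂φ/∂ξ₂`. -/
def d2 {M : PeriodicMedium} (φ : M.H1p) : ℝ × ℝ → ℂ := φ.1 2

lemma weakDeriv_zero (M : PeriodicMedium) {e : ℝ × ℝ} {g : M.L2Y}
    (h : M.HasWeakDeriv e 0 g) : g = 0 := by
  have hY : IsOpen M.Y := isOpen_Ioo.prod isOpen_Ioo
  have hfin : IsFiniteMeasure (volume.restrict M.Y) := by
    refine ⟨?_⟩
    rw [Measure.restrict_apply_univ]
    exact (measure_mono (prod_mono Ioo_subset_Icc_self Ioo_subset_Icc_self)).trans_lt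
      ((isCompact_Icc (a := (0 : ℝ)) (b := M.ℓ)).prod
        (isCompact_Icc (a := (0 : ℝ)) (b := M.d))).measure_lt_top
  have hi : IntegrableOn g M.Y := (Lp.memLp g).integrable (by norm_num)
  have := hY.ae_eq_zero_of_integral_contDiff_smul_eq_zero hi.locallyIntegrableOn
    (fun θ h1 h2 h3 => by
      have hη : ContDiff ℝ (⊤ : ℕ∞) (fun ξ => (θ ξ : ℂ)) := Complex.ofRealCLM.contDiff.comp h1
      have hs : tsupport (fun ξ => (θ ξ : ℂ)) ⊆ tsupport θ :=
        closure_mono (fun x hx => by simpa using hx)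
      have hc : HasCompactSupport (fun ξ => (θ ξ : ℂ)) :=
        h2.of_isClosed_subset (isClosed_tsupport _) hs
      have a := h _ hη hc (hs.trans h3)
      have b : ∫ ξ in M.Y, (0 : M.L2Y) ξ * fderiv ℝ (fun ξ => (θ ξ : ℂ)) ξ e = 0 := by
        apply integral_eq_zero_of_ae
        filter_upwards [Lp.coeFn_zero ℂ 2 (volume.restrict M.Y)] with x hx
        rw [hx]; simp
      rw [b, eq_comm, neg_eq_zero] at a
      rw [← a, ← setIntegral_eq_integral_of_forall_compl_eq_zero (s := M.Y)]
      · simp [mul_comm]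
      · intro x hx
        rw [image_eq_zero_of_notMem_tsupport (fun hx' => hx (h3 hx')), zero_smul])
  rw [Lp.eq_zero_iff_ae_eq_zero]
  exact (ae_restrict_iff' hY.measurableSet).2 this

/-- An element of `H¹_p(Y)` is determined by the function alone, i.e. `H¹_p(Y)` embeds into
`L²(Y)`. -/
lemma fn_ae_zero_iff {M : PeriodicMedium} (φ : M.H1p) :
    fn φ =ᵐ[volume.restrict M.Y] 0 ↔ φ = 0 := by
  constructor
  · intro h
    have h0 : φ.1 0 = 0 := (Lp.eq_zero_iff_ae_eq_zero).2 h
    obtain ⟨a, b, -⟩ := φ.2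
    rw [h0] at a b
    apply Subtype.ext
    ext1 i
    fin_cases i
    · exact h0
    · exact M.weakDeriv_zero a
    · exact M.weakDeriv_zero b
  · rintro rfl
    exact Lp.coeFn_zero _ _ _

/-! ### Completeness -/

lemma exists_trace {μ : Measure (ℝ × ℝ)} {σ : Measure ℝ} {π : ℝ × ℝ → ℝ} {c : ℝ≥0∞}
    (hc : c ≠ ⊤) (hc0 : c ≠ 0) (hπ : MeasurePreserving π μ (c • σ)) (w : Lp ℂ 2 μ) :
    ∃ t : Lp ℂ 2 σ, ∀ k : ℝ → ℂ, MemLp k 2 σ → ∫ y, t y * k y ∂σ = ∫ ξ, w ξ * k (π ξ) ∂μ := by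
  let N : Lp ℂ 2 (c • σ) →L[ℂ] Lp ℂ 2 μ :=
    (Lp.compMeasurePreservingₗᵢ ℂ π hπ).toContinuousLinearMap
  let s : Lp ℂ 2 (c • σ) := N.adjoint w
  have hle : σ ≤ c⁻¹ • (c • σ) := by
    rw [smul_smul, ENNReal.inv_mul_cancel hc0 hc, one_smul]
  have hs : MemLp s 2 σ := (Lp.memLp s).of_measure_le_smul (by simpa using hc0) hle
  have hac : σ ≪ c • σ := Measure.absolutelyContinuous_of_le_smul hle
  refine ⟨c.toReal • hs.toLp s, fun k hk => ?_⟩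
  have hk' : MemLp (fun y => conj (k y)) 2 (c • σ) :=
    hk.star.smul_measure hc
  have h1 : inner ℂ (hk'.toLp _) s = inner ℂ (N (hk'.toLp _)) w :=
    ContinuousLinearMap.adjoint_inner_right N _ _
  rw [L2.inner_def, L2.inner_def, integral_smul_measure] at h1
  have h2 : ∫ a, inner ℂ (hk'.toLp _ a) (s a) ∂σ = ∫ y, s y * k y ∂σ := by
    apply integral_congr_ae
    filter_upwards [hac.ae_le hk'.coeFn_toLp] with y hy
    rw [hy]
    simp [mul_comm]
  have h3 : ∫ a, inner ℂ (N (hk'.toLp _) a) (w a) ∂μ = ∫ ξ, w ξ * k (π ξ) ∂μ := by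
    apply integral_congr_ae
    have e1 : N (hk'.toLp _) =ᵐ[μ] (hk'.toLp _) ∘ π := Lp.coeFn_compMeasurePreserving _ hπ
    filter_upwards [e1, hπ.quasiMeasurePreserving.ae_eq_comp hk'.coeFn_toLp] with y hy hy'
    rw [hy, hy']
    simp [mul_comm]
  rw [h2, h3] at h1
  rw [← h1, ← integral_smul]
  apply integral_congr_ae
  filter_upwards [Lp.coeFn_smul c.toReal (hs.toLp s), hs.coeFn_toLp] with y hy hy'
  rw [hy, Pi.smul_apply, hy', smul_mul_assoc]

lemma isClosed_trace (M : PeriodicMedium) (i : Fin 3) {e : ℝ × ℝ} {X π : ℝ × ℝ →L[ℝ] ℝ}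
    {ι : ℝ →L[ℝ] ℝ × ℝ} {L a : ℝ} (hL : L ≠ 0) {c : ℝ≥0∞} (hc : c ≠ ⊤) (hc0 : c ≠ 0)
    (hπ : MeasurePreserving π (volume.restrict M.Y) (c • volume.restrict (Ioo 0 a)))
    (hXe : X e = 1) (hπe : π e = 0) (hXι : ∀ y, X (ι y) = 0) (hπι : ∀ y, π (ι y) = y) :
    IsClosed {u : PiLp 2 (fun _ : Fin 3 => M.L2Y) | ∃ t : Lp ℂ 2 (volume.restrict (Ioo 0 a)),
      ∀ η : ℝ × ℝ → ℂ, ContDiff ℝ (⊤ : ℕ∞) η →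
        ∫ ξ in M.Y, (u 0 ξ * fderiv ℝ η ξ e + u i ξ * η ξ) =
          ∫ y in Ioo 0 a, (t y * η (ι y + L • e) - t y * η (ι y))} := by
  have hm := fun {h : ℝ × ℝ → ℂ} (hh : Continuous h) => M.memLp_Y hh
  have hsplit : ∀ (u : PiLp 2 (fun _ : Fin 3 => M.L2Y)) (η : ℝ × ℝ → ℂ) (h : ContDiff ℝ (⊤ : ℕ∞) η),
      ∫ ξ in M.Y, (u 0 ξ * fderiv ℝ η ξ e + u i ξ * η ξ) =
        pair (hm (cont_fderiv h e)) (u 0) + pair (hm h.continuous) (u i) := by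
    intro u η h
    rw [integral_add (integrable_mul (Lp.memLp _) (hm (cont_fderiv h _)))
      (integrable_mul (Lp.memLp _) (hm h.continuous)), pair_apply, pair_apply]
  have hset : {u : PiLp 2 (fun _ : Fin 3 => M.L2Y) |
      ∃ t : Lp ℂ 2 (volume.restrict (Ioo 0 a)),
      ∀ η : ℝ × ℝ → ℂ, ContDiff ℝ (⊤ : ℕ∞) η →
        ∫ ξ in M.Y, (u 0 ξ * fderiv ℝ η ξ e + u i ξ * η ξ) =
          ∫ y in Ioo 0 a, (t y * η (ι y + L • e) - t y * η (ι y))} =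
      ⋂ η : {η : ℝ × ℝ → ℂ // ContDiff ℝ (⊤ : ℕ∞) η ∧ ∀ y, η (ι y + L • e) = η (ι y)},
        {u | pair (hm (cont_fderiv η.2.1 e)) (u 0) + pair (hm η.2.1.continuous) (u i) = 0} := by
    ext u
    simp only [mem_ofPred_eq, mem_iInter]
    constructor
    · rintro ⟨t, ht⟩ ⟨η, h1, h2⟩
      have := ht η h1
      rw [hsplit u η h1] at this
      simpa [h2] using this
    · intro h
      have hXc : Continuous fun ξ : ℝ × ℝ => ((X ξ / L : ℝ) : ℂ) := by fun_prop
      have hw : MemLp (fun ξ => (L⁻¹ : ℂ) * u 0 ξ + ((X ξ / L : ℝ) : ℂ) * u i ξ) 2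
          (volume.restrict M.Y) := by
        refine ((Lp.memLp (u 0)).const_mul _).add ?_
        obtain ⟨C, hC⟩ := (((isCompact_Icc (a := (0 : ℝ)) (b := M.ℓ)).prod
          (isCompact_Icc (a := (0 : ℝ)) (b := M.d))).exists_bound_of_continuousOn
            hXc.continuousOn)
        refine MemLp.of_le_mul (c := C) (Lp.memLp (u i))
          (hXc.aestronglyMeasurable.mul (Lp.aestronglyMeasurable _)) ?_
        refine (ae_restrict_iff' (measurableSet_Ioo.prod measurableSet_Ioo)).2
          (Filter.Eventually.of_forall fun ξ hξ => ?_)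
        rw [norm_mul]
        exact mul_le_mul_of_nonneg_right
          (hC ξ ⟨Ioo_subset_Icc_self hξ.1, Ioo_subset_Icc_self hξ.2⟩) (norm_nonneg _)
      obtain ⟨t, ht⟩ := exists_trace hc hc0 hπ (hw.toLp _)
      refine ⟨t, fun η hη => ?_⟩
      let k : ℝ → ℂ := fun y => η (ι y + L • e) - η (ι y)
      have hk : ContDiff ℝ (⊤ : ℕ∞) k := by
        apply ContDiff.sub
        · exact hη.comp (ι.contDiff.add contDiff_const)
        · exact hη.comp ι.contDiff
      let q : ℝ × ℝ → ℂ := fun ξ => ((X ξ / L : ℝ) : ℂ) * k (π ξ)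
      have hq : ContDiff ℝ (⊤ : ℕ∞) q :=
        (Complex.ofRealCLM.contDiff.comp (X.contDiff.div_const L)).mul (hk.comp π.contDiff)
      have hdq : ∀ ξ, fderiv ℝ q ξ e = (L⁻¹ : ℂ) * k (π ξ) := by
        intro ξ
        have hline : HasDerivAt (fun s : ℝ => q (ξ + s • e)) (fderiv ℝ q ξ e) 0 := by
          have h1 : HasFDerivAt q (fderiv ℝ q ξ) (ξ + (0 : ℝ) • e) := by
            simpa using (hq.differentiable (by simp) ξ).hasFDerivAt
          have h2 : HasDerivAt (fun s : ℝ => ξ + s • e) e 0 := by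
            simpa using ((hasDerivAt_id (0 : ℝ)).smul_const e).const_add ξ
          exact h1.comp_hasDerivAt (0 : ℝ) h2
        have hexp : (fun s : ℝ => q (ξ + s • e)) =
            fun s : ℝ => (((X ξ + s) / L : ℝ) : ℂ) * k (π ξ) := by
          funext s
          simp [q, hXe, hπe]
        rw [hexp] at hline
        have h3 : HasDerivAt (fun s : ℝ => (((X ξ + s) / L : ℝ) : ℂ) * k (π ξ))
            (((1 / L : ℝ) : ℂ) * k (π ξ)) 0 :=
          ((((hasDerivAt_id (0 : ℝ)).const_add (X ξ)).div_const L).ofReal_comp).mul_const _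
        rw [hline.unique h3]
        simp
      let ζ : ℝ × ℝ → ℂ := fun ξ => η ξ - q ξ
      have hζ : ContDiff ℝ (⊤ : ℕ∞) ζ := hη.sub hq
      have hζp : ∀ y, ζ (ι y + L • e) = ζ (ι y) := by
        intro y
        simp [ζ, q, k, hXe, hπe, hXι, hπι, hL]
      have h0 := h ⟨ζ, hζ, hζp⟩
      have e1 := pair_apply (hm (cont_fderiv hζ e)) (u 0)
      have e2 := pair_apply (hm hζ.continuous) (u i)
      have hdζ : ∀ ξ, fderiv ℝ ζ ξ e = fderiv ℝ η ξ e - fderiv ℝ q ξ e := by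
        intro ξ
        have := fderiv_fun_sub (hη.differentiable (by simp) ξ) (hq.differentiable (by simp) ξ)
        simp only [ζ]
        rw [this]
        rfl
      have hkk := ht k (memLp_Ioo hk.continuous)
      have hR : ∫ y in Ioo 0 a, (t y * η (ι y + L • e) - t y * η (ι y)) =
          ∫ y in Ioo 0 a, t y * k y := by
        simp only [k, mul_sub]
      have hW : ∫ ξ in M.Y, (hw.toLp _) ξ * k (π ξ) =
          (∫ ξ in M.Y, u 0 ξ * fderiv ℝ q ξ e) + ∫ ξ in M.Y, u i ξ * q ξ := by
        rw [← integral_add (integrable_mul (Lp.memLp _) (hm (cont_fderiv hq _)))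
          (integrable_mul (Lp.memLp _) (hm hq.continuous))]
        apply integral_congr_ae
        filter_upwards [hw.coeFn_toLp] with ξ hξ
        rw [hξ, hdq ξ]
        simp only [q]
        ring
      have s1 : ∫ ξ in M.Y, u 0 ξ * fderiv ℝ ζ ξ e =
          (∫ ξ in M.Y, u 0 ξ * fderiv ℝ η ξ e) - ∫ ξ in M.Y, u 0 ξ * fderiv ℝ q ξ e := by
        rw [← integral_sub (integrable_mul (Lp.memLp _) (hm (cont_fderiv hη _)))
          (integrable_mul (Lp.memLp _) (hm (cont_fderiv hq _)))]
        simp only [hdζ, mul_sub]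
      have s2 : ∫ ξ in M.Y, u i ξ * ζ ξ =
          (∫ ξ in M.Y, u i ξ * η ξ) - ∫ ξ in M.Y, u i ξ * q ξ := by
        rw [← integral_sub (integrable_mul (Lp.memLp _) (hm hη.continuous))
          (integrable_mul (Lp.memLp _) (hm hq.continuous))]
        simp only [ζ, mul_sub]
      rw [hR, hkk, hW, hsplit u η hη, pair_apply, pair_apply]
      have h0' : pair (hm (cont_fderiv hζ e)) (u 0) + pair (hm hζ.continuous) (u i) = 0 := h0
      rw [e1, e2, s1, s2] at h0'
      linear_combination h0'
  rw [hset]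
  refine isClosed_iInter fun η => isClosed_eq ?_ continuous_const
  exact ((pair _).continuous.comp (PiLp.continuous_apply 2 _ 0)).add
    ((pair _).continuous.comp (PiLp.continuous_apply 2 _ i))

lemma isClosed_weakDeriv (M : PeriodicMedium) (i : Fin 3) (e : ℝ × ℝ) :
    IsClosed {u : PiLp 2 (fun _ : Fin 3 => M.L2Y) | M.HasWeakDeriv e (u 0) (u i)} := by
  simp only [HasWeakDeriv, ofPred_forall]
  refine isClosed_iInter fun η => isClosed_iInter fun h => isClosed_iInter fun _ =>
    isClosed_iInter fun _ => ?_
  simp only [← pair_apply (M.memLp_Y (cont_fderiv h e)), ← pair_apply (M.memLp_Y h.continuous)]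
  exact isClosed_eq ((pair _).continuous.comp (PiLp.continuous_apply 2 _ 0))
    ((pair _).continuous.comp (PiLp.continuous_apply 2 _ i)).neg

lemma measure_Y (M : PeriodicMedium) : (volume : Measure (ℝ × ℝ)).restrict M.Y =
    (volume.restrict (Ioo 0 M.ℓ)).prod (volume.restrict (Ioo 0 M.d)) := by
  rw [Measure.prod_restrict]; rfl

lemma isClosed_H1p (M : PeriodicMedium) :
    IsClosed (M.H1p : Set (PiLp 2 (fun _ : Fin 3 => M.L2Y))) := by
  have h1 := M.isClosed_weakDeriv 1 (1, 0)
  have h2 := M.isClosed_weakDeriv 2 (0, 1)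
  have h3 := M.isClosed_trace 1 (e := (1, 0)) (X := .fst ℝ ℝ ℝ) (π := .snd ℝ ℝ ℝ)
    (ι := .inr ℝ ℝ ℝ) (L := M.ℓ) (a := M.d) M.ℓ_pos.ne' (c := ENNReal.ofReal M.ℓ) (by simp)
    (by simpa using M.ℓ_pos)
    ⟨measurable_snd, by
      rw [measure_Y]; simp [Measure.map_snd_prod]⟩
    (by simp) (by simp) (by simp) (by simp)
  have h4 := M.isClosed_trace 2 (e := (0, 1)) (X := .snd ℝ ℝ ℝ) (π := .fst ℝ ℝ ℝ)
    (ι := .inl ℝ ℝ ℝ) (L := M.d) (a := M.ℓ) M.d_pos.ne' (c := ENNReal.ofReal M.d) (by simp)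
    (by simpa using M.d_pos)
    ⟨measurable_fst, by
      rw [measure_Y]; simp [Measure.map_fst_prod]⟩
    (by simp) (by simp) (by simp) (by simp)
  have := h1.inter (h2.inter (h3.inter h4))
  convert this using 1
  ext u
  simp [H1p, IsH1p, HasTracesFst, HasTracesSnd]

instance (M : PeriodicMedium) : CompleteSpace M.H1p := M.isClosed_H1p.completeSpace_coe

/-! ### The sesquilinear forms and the operators -/

/-- `∫_Y G φ ψ̄`. -/
def formC (M : PeriodicMedium) (φ ψ : M.H1p) : ℂ :=
  ∫ ξ in M.Y, (M.G ξ : ℂ) * fn φ ξ * conj (fn ψ ξ)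

/-- `-i ∫_Y G (∂φ/∂ξ₁ ψ̄ - φ ∂ψ̄/∂ξ₁)`. -/
def formB (M : PeriodicMedium) (φ ψ : M.H1p) : ℂ :=
  -Complex.I * ∫ ξ in M.Y, (M.G ξ : ℂ) * (d1 φ ξ * conj (fn ψ ξ) - fn φ ξ * conj (d1 ψ ξ))

/-- `k₂² ∫_Y G φ ψ̄ - k₂ i ∫_Y G (∂φ/∂ξ₂ ψ̄ - φ ∂ψ̄/∂ξ₂) - ω² ∫_Y ρ φ ψ̄ + ∫_Y G ∇φ · ∇ψ̄`. -/
def formA (M : PeriodicMedium) (ω k₂ : ℝ) (φ ψ : M.H1p) : ℂ :=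
  (k₂ : ℂ) ^ 2 * (∫ ξ in M.Y, (M.G ξ : ℂ) * fn φ ξ * conj (fn ψ ξ))
  - (k₂ : ℂ) * Complex.I *
      (∫ ξ in M.Y, (M.G ξ : ℂ) * (d2 φ ξ * conj (fn ψ ξ) - fn φ ξ * conj (d2 ψ ξ)))
  - (ω : ℂ) ^ 2 * (∫ ξ in M.Y, (M.ρ ξ : ℂ) * fn φ ξ * conj (fn ψ ξ))
  + ∫ ξ in M.Y, (M.G ξ : ℂ) * (d1 φ ξ * conj (d1 ψ ξ) + d2 φ ξ * conj (d2 ψ ξ))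

/-- `κ` is an eigenvalue of the quadratic eigenvalue problem in weak form at `(ω, k₂)`: some
nonzero `φ ∈ H¹_p(Y)` satisfies the weak equation for every `ψ ∈ H¹_p(Y)`. -/
def IsEigenvalue (M : PeriodicMedium) (ω k₂ : ℝ) (κ : ℂ) : Prop :=
  ∃ φ : M.H1p, φ ≠ 0 ∧ ∀ ψ : M.H1p,
    κ ^ 2 * (∫ ξ in M.Y, (M.G ξ : ℂ) * fn φ ξ * conj (fn ψ ξ))
    - κ * (Complex.I *
        ∫ ξ in M.Y, (M.G ξ : ℂ) * (d1 φ ξ * conj (fn ψ ξ) - fn φ ξ * conj (d1 ψ ξ)))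
    + ((k₂ : ℂ) ^ 2 * (∫ ξ in M.Y, (M.G ξ : ℂ) * fn φ ξ * conj (fn ψ ξ))
      - (k₂ : ℂ) * Complex.I *
          (∫ ξ in M.Y, (M.G ξ : ℂ) * (d2 φ ξ * conj (fn ψ ξ) - fn φ ξ * conj (d2 ψ ξ)))
      - (ω : ℂ) ^ 2 * (∫ ξ in M.Y, (M.ρ ξ : ℂ) * fn φ ξ * conj (fn ψ ξ))
      + ∫ ξ in M.Y, (M.G ξ : ℂ) * (d1 φ ξ * conj (d1 ψ ξ) + d2 φ ξ * conj (d2 ψ ξ))) = 0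

lemma memLp_top {μ : Measure (ℝ × ℝ)} {f : ℝ × ℝ → ℝ} {a b : ℝ}
    (hf : AEStronglyMeasurable f μ) (ha : 0 < a) (h : ∀ᵐ ξ ∂μ, a ≤ f ξ ∧ f ξ ≤ b) :
    MemLp (fun ξ => (f ξ : ℂ)) ⊤ μ := by
  refine memLp_top_of_bound (Complex.continuous_ofReal.comp_aestronglyMeasurable hf) b ?_
  filter_upwards [h] with ξ hξ
  simpa [abs_of_pos (ha.trans_le hξ.1)] using hξ.2

lemma memLp_G (M : PeriodicMedium) : MemLp (fun ξ => (M.G ξ : ℂ)) ⊤ (volume.restrict M.Y) :=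
  memLp_top M.G_meas M.Ginf_pos M.G_bound

lemma memLp_ρ (M : PeriodicMedium) : MemLp (fun ξ => (M.ρ ξ : ℂ)) ⊤ (volume.restrict M.Y) :=
  memLp_top M.ρ_meas M.ρinf_pos M.ρ_bound

lemma integrable_form (M : PeriodicMedium) {a : ℝ × ℝ → ℂ}
    (ha : MemLp a ⊤ (volume.restrict M.Y)) (u v : M.L2Y) :
    Integrable (fun ξ => a ξ * (u ξ * conj (v ξ))) (volume.restrict M.Y) := by
  have h1 : MemLp (fun ξ => a ξ * u ξ) 2 (volume.restrict M.Y) := (Lp.memLp u).mul ha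
  simpa [mul_assoc] using integrable_mul h1 (Lp.memLp v).star

lemma exists_op (M : PeriodicMedium) {a : ℝ × ℝ → ℂ} (ha : MemLp a ⊤ (volume.restrict M.Y))
    (i j : Fin 3) : ∃ T : M.H1p →L[ℂ] M.H1p, ∀ φ ψ : M.H1p,
      inner ℂ ψ (T φ) = ∫ ξ in M.Y, a ξ * (φ.1 i ξ * conj (ψ.1 j ξ)) := by
  let P : Fin 3 → (M.H1p →L[ℂ] M.L2Y) := fun i =>
    (PiLp.proj 2 (fun _ : Fin 3 => M.L2Y) i : _ →L[ℂ] M.L2Y) ∘L M.H1p.subtypeL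
  let m : M.L2Y →L[ℂ] M.L2Y :=
    (ContinuousLinearMap.mul ℂ ℂ).holderL (volume.restrict M.Y) ⊤ 2 2 (ha.toLp a)
  refine ⟨(P j).adjoint ∘L m ∘L (P i), fun φ ψ => ?_⟩
  simp only [ContinuousLinearMap.comp_apply]
  rw [ContinuousLinearMap.adjoint_inner_right, L2.inner_def]
  apply integral_congr_ae
  have h1 : m (P i φ) =ᵐ[volume.restrict M.Y] _ :=
    (ContinuousLinearMap.mul ℂ ℂ).coeFn_holder (ha.toLp a) (P i φ)
  filter_upwards [h1, ha.coeFn_toLp] with ξ h2 h3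
  rw [h2, h3]
  simp [P, mul_assoc]

lemma exists_opC (M : PeriodicMedium) :
    ∃ T : M.H1p →L[ℂ] M.H1p, ∀ φ ψ : M.H1p, inner ℂ ψ (T φ) = M.formC φ ψ := by
  obtain ⟨T, hT⟩ := M.exists_op M.memLp_G 0 0
  exact ⟨T, fun φ ψ => by simp only [hT, formC, fn, mul_assoc]⟩

lemma exists_opB (M : PeriodicMedium) :
    ∃ T : M.H1p →L[ℂ] M.H1p, ∀ φ ψ : M.H1p, inner ℂ ψ (T φ) = M.formB φ ψ := by
  obtain ⟨T, hT⟩ := M.exists_op M.memLp_G 1 0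
  obtain ⟨S, hS⟩ := M.exists_op M.memLp_G 0 1
  refine ⟨-Complex.I • (T - S), fun φ ψ => ?_⟩
  have hi := M.integrable_form M.memLp_G
  simp only [formB, fn, d1, mul_sub]
  rw [integral_sub (hi _ _) (hi _ _), _root_.smul_apply, inner_smul_right,
    _root_.sub_apply, inner_sub_right, hT, hS, mul_sub]

lemma exists_opA (M : PeriodicMedium) (ω k₂ : ℝ) :
    ∃ T : M.H1p →L[ℂ] M.H1p, ∀ φ ψ : M.H1p, inner ℂ ψ (T φ) = M.formA ω k₂ φ ψ := by
  obtain ⟨T₁, h₁⟩ := M.exists_op M.memLp_G 0 0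
  obtain ⟨T₂, h₂⟩ := M.exists_op M.memLp_G 2 0
  obtain ⟨T₃, h₃⟩ := M.exists_op M.memLp_G 0 2
  obtain ⟨T₄, h₄⟩ := M.exists_op M.memLp_ρ 0 0
  obtain ⟨T₅, h₅⟩ := M.exists_op M.memLp_G 1 1
  obtain ⟨T₆, h₆⟩ := M.exists_op M.memLp_G 2 2
  refine ⟨(k₂ : ℂ) ^ 2 • T₁ - ((k₂ : ℂ) * Complex.I) • (T₂ - T₃) - (ω : ℂ) ^ 2 • T₄ + (T₅ + T₆),
    fun φ ψ => ?_⟩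
  have hi := M.integrable_form M.memLp_G
  simp only [formA, fn, d1, d2, mul_sub, mul_add]
  rw [integral_sub (hi _ _) (hi _ _), integral_add (hi _ _) (hi _ _)]
  have hs : ∀ (c : ℂ) (T : M.H1p →L[ℂ] M.H1p), inner ℂ ψ ((c • T) φ) = c * inner ℂ ψ (T φ) :=
    fun c T => by rw [_root_.smul_apply, inner_smul_right]
  rw [_root_.add_apply, _root_.sub_apply, _root_.sub_apply, _root_.add_apply, inner_add_right,
    inner_sub_right, inner_sub_right, inner_add_right, hs, hs, hs, _root_.sub_apply,
    inner_sub_right, h₁, h₂, h₃, h₄, h₅, h₆]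
  simp only [mul_assoc, mul_sub]

/-- The bounded operator `𝒜` on `H¹_p(Y)` defined by `⟨𝒜φ, ψ⟩ = formA φ ψ` (the pairing being
linear in the first entry, which is the second entry of `inner`). -/
def opA (M : PeriodicMedium) (ω k₂ : ℝ) : M.H1p →L[ℂ] M.H1p := (M.exists_opA ω k₂).choose

/-- The bounded operator `ℬ` on `H¹_p(Y)` defined by `⟨ℬφ, ψ⟩ = formB φ ψ`. -/
def opB (M : PeriodicMedium) : M.H1p →L[ℂ] M.H1p := M.exists_opB.choose

/-- The bounded operator `𝒞` on `H¹_p(Y)` defined by `⟨𝒞φ, ψ⟩ = formC φ ψ`. -/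
def opC (M : PeriodicMedium) : M.H1p →L[ℂ] M.H1p := M.exists_opC.choose

lemma inner_opA (M : PeriodicMedium) (ω k₂ : ℝ) (φ ψ : M.H1p) :
    inner ℂ ψ (M.opA ω k₂ φ) = M.formA ω k₂ φ ψ := (M.exists_opA ω k₂).choose_spec φ ψ

lemma inner_opB (M : PeriodicMedium) (φ ψ : M.H1p) :
    inner ℂ ψ (M.opB φ) = M.formB φ ψ := M.exists_opB.choose_spec φ ψ

lemma inner_opC (M : PeriodicMedium) (φ ψ : M.H1p) :
    inner ℂ ψ (M.opC φ) = M.formC φ ψ := M.exists_opC.choose_spec φ ψ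

/-- The quadratic operator pencil `𝒯(z) = 𝒜 + z ℬ + z² 𝒞`. -/
def pencil (M : PeriodicMedium) (ω k₂ : ℝ) (z : ℂ) : M.H1p →L[ℂ] M.H1p :=
  M.opA ω k₂ + z • M.opB + z ^ 2 • M.opC

end PeriodicMedium

end

/-!
Each of the forms defining `𝒜`, `ℬ`, `𝒞` is Hermitian, so `𝒯(z)† = 𝒯(z̄)`, and one has to show that
a nontrivial kernel of `𝒯(z)` passes to its adjoint. For a general operator it need not; it does
for `S + K` with `S` invertible and `K` compact, because `K†` is then compact too (Schauder) and an
injective compact perturbation of an invertible operator is invertible (Fredholm alternative).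

The decomposition takes for `S` the operator of the form `∫ G (φ ψ̄ + ∇φ · ∇ψ̄)`, which is coercive
since `G ≥ G_inf > 0`. Every other term of the pencil involves `φ` or `ψ` without a derivative,
hence factors through the embedding `H¹_p(Y) → L²(Y)` or its adjoint. That embedding is compact:
testing the weak derivatives against periodic exponentials shows that the Fourier coefficients of
`∂φ/∂ξⱼ` are those of `φ` times `i` times the frequency, so the Fourier tails of `φ` are uniformly
small.
-/

noncomputable section

/-! ### Compact operators and the Fredholm alternative -/

lemma exists_ne_zero_add_apply_eq_zero_of_not_isUnit {𝕜 X : Type*} [NontriviallyNormedField 𝕜]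
    [NormedAddCommGroup X] [NormedSpace 𝕜 X] [CompleteSpace X] {S K : X →L[𝕜] X}
    (hS : IsUnit S) (hK : IsCompactOperator K) (h : ¬ IsUnit (S + K)) :
    ∃ x ≠ 0, (S + K) x = 0 := by
  obtain ⟨u, rfl⟩ := hS
  let C : X →L[𝕜] X := -((↑u⁻¹ : X →L[𝕜] X) * K)
  have hC : IsCompactOperator C := (hK.clm_comp (↑u⁻¹ : X →L[𝕜] X)).neg
  have hfactor : (u : X →L[𝕜] X) + K = u * (1 - C) := by
    rw [sub_neg_eq_add, mul_add, mul_one, ← mul_assoc, Units.mul_inv, one_mul]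
  rcases hC.hasEigenvalue_or_mem_resolventSet one_ne_zero with heigen | hres
  · obtain ⟨x, hx⟩ := heigen.exists_hasEigenvector
    have hfix : C x = x := by simpa using hx.apply_eq_smul
    refine ⟨x, hx.2, ?_⟩
    rw [hfactor, mul_apply_eq_comp, _root_.sub_apply, one_apply_eq_self, hfix, sub_self, map_zero]
  · rw [spectrum.mem_resolventSet_iff, map_one] at hres
    exact absurd (hfactor ▸ u.isUnit.mul hres) h

section CompactOperators

variable {𝕜 E F : Type*} [RCLike 𝕜]
  [NormedAddCommGroup E] [InnerProductSpace 𝕜 E] [CompleteSpace E]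
  [NormedAddCommGroup F] [InnerProductSpace 𝕜 F] [CompleteSpace F]

lemma sq_norm_apply_le_norm_mul_norm_adjoint_comp_self_apply (T : E →L[𝕜] F) (x : E) :
    ‖T x‖ ^ 2 ≤ ‖x‖ * ‖(T.adjoint ∘L T) x‖ := by
  rw [← inner_self_eq_norm_sq (𝕜 := 𝕜), ← ContinuousLinearMap.adjoint_inner_right]
  exact re_inner_le_norm _ _

lemma isCompactOperator_of_adjoint_comp_self {T : E →L[𝕜] F}
    (hT : IsCompactOperator (T.adjoint ∘L T)) : IsCompactOperator T := by
  have hTT : TotallyBounded ((T.adjoint ∘L T) '' Metric.closedBall 0 1) :=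
    (hT.isCompact_closure_image_closedBall
      (f := (T.adjoint ∘L T).toLinearMap) 1).totallyBounded.subset subset_closure
  refine (isCompactOperator_iff_isCompact_closure_image_closedBall (T : E →ₗ[𝕜] F) one_pos).2 ?_
  refine TotallyBounded.isCompact_of_isClosed
    (Metric.totallyBounded_iff.2 fun ε hε => ?_).closure isClosed_closure
  obtain ⟨t, ht, htfin, hcover⟩ :=
    Metric.finite_approx_of_totallyBounded hTT (ε ^ 2 / 2) (by positivity)
  obtain ⟨s, hs, hsfin, rfl⟩ := exists_subset_image_finite_and.1 ⟨t, ht, htfin, rfl⟩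
  refine ⟨T '' s, hsfin.image T, ?_⟩
  rintro _ ⟨x, hx, rfl⟩
  obtain ⟨y, hy, hxy⟩ : ∃ y ∈ s, ‖(T.adjoint ∘L T) (x - y)‖ < ε ^ 2 / 2 := by
    simpa only [mem_iUnion₂, exists_mem_image, Metric.mem_ball, dist_eq_norm, map_sub,
      exists_prop] using hcover ⟨x, hx, rfl⟩
  have hball : ‖x - y‖ ≤ 2 := by
    have := norm_sub_le x y
    have := mem_closedBall_zero_iff.1 hx
    have := mem_closedBall_zero_iff.1 (hs hy)
    linarith
  have hdist : ‖T (x - y)‖ < ε := by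
    refine lt_of_pow_lt_pow_left₀ 2 hε.le ?_
    calc ‖T (x - y)‖ ^ 2 ≤ ‖x - y‖ * ‖(T.adjoint ∘L T) (x - y)‖ :=
          sq_norm_apply_le_norm_mul_norm_adjoint_comp_self_apply T _
      _ ≤ 2 * ‖(T.adjoint ∘L T) (x - y)‖ := by gcongr
      _ < ε ^ 2 := by linarith
  refine mem_iUnion₂.2 ⟨T y, mem_image_of_mem T hy, ?_⟩
  rwa [Metric.mem_ball, dist_eq_norm, ContinuousLinearMap.coe_coe, ← map_sub]

lemma isCompactOperator_adjoint {T : E →L[𝕜] F} (hT : IsCompactOperator T) :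
    IsCompactOperator T.adjoint := by
  refine isCompactOperator_of_adjoint_comp_self ?_
  rw [ContinuousLinearMap.adjoint_adjoint]
  exact hT.comp_clm T.adjoint

lemma exists_ne_zero_adjoint_add_apply_eq_zero {S K : E →L[𝕜] E} (hS : IsUnit S)
    (hK : IsCompactOperator K) (h : ∃ x ≠ 0, (S + K) x = 0) :
    ∃ y ≠ 0, (S + K).adjoint y = 0 := by
  obtain ⟨x, hx, hSKx⟩ := h
  have hnot : ¬ IsUnit (S + K) := fun hu =>
    hx ((ContinuousLinearMap.isUnit_iff_bijective.1 hu).1 (hSKx.trans (map_zero _).symm))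
  rw [← isUnit_star, star_add] at hnot
  rw [map_add]
  exact exists_ne_zero_add_apply_eq_zero_of_not_isUnit hS.star
    (isCompactOperator_adjoint hK) hnot

end CompactOperators

section Basis

variable {𝕜 ι κ H L : Type*} [RCLike 𝕜] [NormedAddCommGroup H] [InnerProductSpace 𝕜 H]
  [NormedAddCommGroup L] [InnerProductSpace 𝕜 L]

lemma hasSum_sq_norm_inner_hilbertBasis (b : HilbertBasis ι 𝕜 L) (x : L) :
    HasSum (fun i => ‖inner 𝕜 (b i) x‖ ^ 2) (‖x‖ ^ 2) := by
  have h := RCLike.hasSum_re 𝕜 (b.hasSum_inner_mul_inner x x)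
  rw [inner_self_eq_norm_sq] at h
  refine h.congr_fun fun i => ?_
  rw [← inner_conj_symm x, RCLike.conj_mul, ← RCLike.ofReal_pow, RCLike.ofReal_re]

lemma sq_norm_le_mul_sum_of_sq_norm_inner_le [Fintype κ] (b : HilbertBasis ι 𝕜 L) {c : ℝ} {y : L}
    {z : κ → L} (h : ∀ i, ‖inner 𝕜 (b i) y‖ ^ 2 ≤ c * ∑ j, ‖inner 𝕜 (b i) (z j)‖ ^ 2) :
    ‖y‖ ^ 2 ≤ c * ∑ j, ‖z j‖ ^ 2 :=
  hasSum_le h (hasSum_sq_norm_inner_hilbertBasis b y)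
    ((hasSum_sum fun j _ => hasSum_sq_norm_inner_hilbertBasis b (z j)).mul_left c)

/-- The coordinate truncation `x ↦ ∑ i ∈ s, ⟪b i, x⟫ b i`, i.e. the orthogonal projection onto the
span of finitely many vectors of an orthonormal family. -/
def truncation (𝕜 : Type*) [RCLike 𝕜] [InnerProductSpace 𝕜 L] (b : ι → L) (s : Finset ι) :
    L →L[𝕜] L :=
  ∑ i ∈ s, InnerProductSpace.rankOne 𝕜 (b i) (b i)

lemma truncation_apply (b : ι → L) (s : Finset ι) (x : L) :
    truncation 𝕜 b s x = ∑ i ∈ s, inner 𝕜 (b i) x • b i := by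
  simp [truncation]

lemma isCompactOperator_truncation (b : ι → L) (s : Finset ι) :
    IsCompactOperator (truncation 𝕜 b s) :=
  (compactOperator (RingHom.id 𝕜) L L).sum_mem fun i _ =>
    (isCompactOperator_of_locallyCompactSpace_rng
      (ContinuousLinearMap.toSpanSingleton 𝕜 (b i))).comp_clm (innerSL 𝕜 (b i))

open Classical in
lemma inner_truncation {b : ι → L} (hb : Orthonormal 𝕜 b) (s : Finset ι) (i : ι) (x : L) :
    inner 𝕜 (b i) (truncation 𝕜 b s x) = if i ∈ s then inner 𝕜 (b i) x else 0 := by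
  rw [truncation_apply]
  split_ifs with h
  · exact hb.inner_right_sum _ h
  · rw [inner_sum]
    refine Finset.sum_eq_zero fun j hj => ?_
    rw [inner_smul_right, hb.2 (ne_of_mem_of_not_mem hj h).symm, mul_zero]

lemma isCompactOperator_of_sq_norm_inner_le [Fintype κ] [CompleteSpace L] (b : HilbertBasis ι 𝕜 L)
    (J : H →L[𝕜] L) (D : κ → H →L[𝕜] L)
    (h : ∀ ε > 0, ∃ s : Finset ι, ∀ i ∉ s, ∀ x,
      ‖inner 𝕜 (b i) (J x)‖ ^ 2 ≤ ε * ∑ j, ‖inner 𝕜 (b i) (D j x)‖ ^ 2) :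
    IsCompactOperator J := by
  classical
  refine isClosed_setOfPred_isCompactOperator.closure_subset
    (Metric.mem_closure_iff.2 fun ε hε => ?_)
  set C := ∑ j, ‖D j‖ ^ 2
  obtain ⟨s, hs⟩ := h ((ε / 2) ^ 2 / (C + 1)) (by positivity)
  refine ⟨truncation 𝕜 b s ∘L J, (isCompactOperator_truncation b s).comp_clm J, ?_⟩
  rw [dist_eq_norm]
  refine (ContinuousLinearMap.opNorm_le_bound _ (half_pos hε).le fun x => ?_).trans_lt
    (half_lt_self hε)
  refine le_of_sq_le_sq ?_ (by positivity)
  calc ‖(J - truncation 𝕜 b s ∘L J) x‖ ^ 2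
      ≤ (ε / 2) ^ 2 / (C + 1) * ∑ j, ‖D j x‖ ^ 2 := by
        refine sq_norm_le_mul_sum_of_sq_norm_inner_le b fun i => ?_
        rw [_root_.sub_apply, inner_sub_right, ContinuousLinearMap.comp_apply,
          inner_truncation b.orthonormal]
        split_ifs with hi
        · rw [sub_self, norm_zero, zero_pow two_ne_zero]
          positivity
        · rw [sub_zero]
          exact hs i hi x
    _ ≤ (ε / 2) ^ 2 / (C + 1) * ∑ j, (‖D j‖ * ‖x‖) ^ 2 := by
        gcongr with j
        exact (D j).le_opNorm x
    _ = C / (C + 1) * (ε / 2 * ‖x‖) ^ 2 := by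
        simp only [mul_pow, ← Finset.sum_mul]
        ring
    _ ≤ (ε / 2 * ‖x‖) ^ 2 :=
        mul_le_of_le_one_left (by positivity) (div_le_one_of_le₀ (by simp) (by positivity))

end Basis

/-! ### Multiplication operators on `L²` -/

section MulLp

variable {α : Type*} [MeasurableSpace α] {μ : Measure α}

/-- Multiplication by an essentially bounded weight as a bounded operator on `L²`. -/
def mulLp {a : α → ℂ} (ha : MemLp a ⊤ μ) : Lp ℂ 2 μ →L[ℂ] Lp ℂ 2 μ :=
  (ContinuousLinearMap.mul ℂ ℂ).holderL μ ⊤ 2 2 (ha.toLp a)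

lemma coeFn_mulLp {a : α → ℂ} (ha : MemLp a ⊤ μ) (u : Lp ℂ 2 μ) :
    mulLp ha u =ᵐ[μ] fun x => a x * u x := by
  have hholder : mulLp ha u =ᵐ[μ] _ :=
    (ContinuousLinearMap.mul ℂ ℂ).coeFn_holder (ha.toLp a) u
  filter_upwards [hholder, ha.coeFn_toLp] with x hx hax
  rw [hx, hax, ContinuousLinearMap.mul_apply']

lemma inner_mulLp {a : α → ℂ} (ha : MemLp a ⊤ μ) (u v : Lp ℂ 2 μ) :
    inner ℂ v (mulLp ha u) = ∫ x, a x * (u x * conj (v x)) ∂μ := by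
  rw [L2.inner_def]
  refine integral_congr_ae ?_
  filter_upwards [coeFn_mulLp ha u] with x hx
  rw [hx, RCLike.inner_apply, mul_assoc]

lemma adjoint_mulLp_ofReal {a : α → ℝ} (ha : MemLp (fun x => (a x : ℂ)) ⊤ μ) :
    (mulLp ha).adjoint = mulLp ha := by
  refine (ContinuousLinearMap.eq_adjoint_iff _ _).2 (fun u v => ?_) |>.symm
  rw [← inner_conj_symm, inner_mulLp, inner_mulLp, ← integral_conj]
  congr 1 with x
  rw [map_mul, map_mul, Complex.conj_ofReal, Complex.conj_conj, mul_comm (conj (u x))]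

lemma mul_sq_norm_le_re_inner_mulLp {a : α → ℝ} (ha : MemLp (fun x => (a x : ℂ)) ⊤ μ) {c : ℝ}
    (hc : ∀ᵐ x ∂μ, c ≤ a x) (u : Lp ℂ 2 μ) :
    c * ‖u‖ ^ 2 ≤ RCLike.re (inner ℂ u (mulLp ha u)) := by
  rw [← inner_self_eq_norm_sq (𝕜 := ℂ), L2.inner_def, L2.inner_def,
    ← integral_re (L2.integrable_inner u u), ← integral_re (L2.integrable_inner u _),
    ← integral_const_mul]
  refine integral_mono_ae ((L2.integrable_inner u u).re.const_mul c)
    (L2.integrable_inner u _).re ?_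
  filter_upwards [hc, coeFn_mulLp ha u] with x hx hmul
  have hnonneg : 0 ≤ RCLike.re (inner ℂ (u x) (u x)) := inner_self_nonneg
  rw [hmul, ← smul_eq_mul (a x : ℂ), inner_smul_right, RCLike.re_eq_complex_re,
    Complex.re_ofReal_mul]
  exact mul_le_mul_of_nonneg_right hx hnonneg

end MulLp

/-! ### Fourier series on the unit cell -/

section RescaledPullback

variable {α β : Type*} [MeasurableSpace α] [MeasurableSpace β] {μ : Measure α} {ν : Measure β}
  {r : α → β} {c : ℝ}

/-- The pullback `√c • (g ∘ r)` of a square-integrable function along a map `r` that preserves the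
measure up to the factor `c⁻¹`; the factor `√c` makes it inner product preserving. -/
def rescaledPullback (hr : MeasurePreserving r μ (ENNReal.ofReal c⁻¹ • ν)) (g : Lp ℂ 2 ν) :
    Lp ℂ 2 μ :=
  (√c : ℂ) • (((Lp.memLp g).smul_measure ENNReal.ofReal_ne_top).comp_measurePreserving hr).toLp _

lemma coeFn_rescaledPullback (hr : MeasurePreserving r μ (ENNReal.ofReal c⁻¹ • ν))
    (g : Lp ℂ 2 ν) : rescaledPullback hr g =ᵐ[μ] fun x => √c * g (r x) := by
  have hg := ((Lp.memLp g).smul_measure ENNReal.ofReal_ne_top).comp_measurePreserving hr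
  filter_upwards [Lp.coeFn_smul (√c : ℂ) (hg.toLp _), hg.coeFn_toLp] with x hsmul hcomp
  rw [rescaledPullback, hsmul, Pi.smul_apply, hcomp, smul_eq_mul, Function.comp_apply]

lemma integral_comp_eq_inv_mul_integral (hc : 0 < c)
    (hr : MeasurePreserving r μ (ENNReal.ofReal c⁻¹ • ν)) {F : β → ℂ}
    (hF : AEStronglyMeasurable F ν) : ∫ x, F (r x) ∂μ = (c : ℂ)⁻¹ * ∫ y, F y ∂ν := by
  have hF' : AEStronglyMeasurable F (μ.map r) := by
    rw [hr.map_eq]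
    exact hF.mono_ac Measure.smul_absolutelyContinuous
  rw [← integral_map hr.measurable.aemeasurable hF', hr.map_eq, integral_smul_measure,
    ENNReal.toReal_ofReal (inv_pos.2 hc).le, Complex.real_smul, Complex.ofReal_inv]

lemma inner_rescaledPullback (hc : 0 < c) (hr : MeasurePreserving r μ (ENNReal.ofReal c⁻¹ • ν))
    (g h : Lp ℂ 2 ν) :
    inner ℂ (rescaledPullback hr g) (rescaledPullback hr h) = inner ℂ g h := by
  have hsqrt : (√c : ℂ) * √c = c := by exact_mod_cast Real.mul_self_sqrt hc.le
  have hae : (fun x => inner ℂ (rescaledPullback hr g x) (rescaledPullback hr h x)) =ᵐ[μ]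
      fun x => (c : ℂ) * inner ℂ (g (r x)) (h (r x)) := by
    filter_upwards [coeFn_rescaledPullback hr g, coeFn_rescaledPullback hr h] with x hgx hhx
    rw [hgx, hhx, ← smul_eq_mul, ← smul_eq_mul, inner_smul_left, inner_smul_right,
      Complex.conj_ofReal, ← mul_assoc, hsqrt]
  rw [L2.inner_def, L2.inner_def, integral_congr_ae hae, integral_const_mul,
    integral_comp_eq_inv_mul_integral hc hr (L2.integrable_inner g h).aestronglyMeasurable,
    mul_inv_cancel_left₀ (by exact_mod_cast hc.ne')]

end RescaledPullback

/-- The representative in `(0, L]` of a point of the unit circle rescaled to length `L`. -/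
def circleLift (L : ℝ) (x : UnitAddCircle) : ℝ := L * (AddCircle.equivIoc 1 0 x : ℝ)

lemma coe_circleLift_div {L : ℝ} (hL : L ≠ 0) (x : UnitAddCircle) :
    ((circleLift L x / L : ℝ) : UnitAddCircle) = x := by
  rw [circleLift, mul_div_cancel_left₀ _ hL]
  exact (AddCircle.equivIoc 1 0).symm_apply_apply x

lemma measurePreserving_coe_equivIoc :
    MeasurePreserving (fun x : UnitAddCircle => (AddCircle.equivIoc 1 0 x : ℝ))
      AddCircle.haarAddCircle (volume.restrict (Ioc 0 1)) := by
  have h := (measurePreserving_subtype_coe (μa := (volume : Measure ℝ))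
    (measurableSet_Ioc (a := (0 : ℝ)) (b := 0 + 1))).comp
    (AddCircle.measurePreserving_equivIoc 1 (a := 0))
  rw [AddCircle.volume_eq_smul_haarAddCircle, ENNReal.ofReal_one, one_smul] at h
  have hIoc : Ioc (0 : ℝ) 1 = Ioc 0 (0 + 1) := by rw [zero_add]
  rw [hIoc]
  exact h

lemma measurePreserving_mul_left_Ioc {L : ℝ} (hL : 0 < L) :
    MeasurePreserving (fun x : ℝ => L * x) (volume.restrict (Ioc 0 1))
      (ENNReal.ofReal L⁻¹ • volume.restrict (Ioc 0 L)) := by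
  refine ⟨measurable_const_mul L, ?_⟩
  have hpre : Ioc (0 : ℝ) 1 = (fun x : ℝ => L * x) ⁻¹' Ioc 0 L := by
    ext x
    simp only [mem_Ioc, mem_preimage, mul_pos_iff_of_pos_left hL, mul_le_iff_le_one_right hL]
  rw [hpre, ← Measure.restrict_map (measurable_const_mul L) measurableSet_Ioc,
    Real.map_volume_mul_left hL.ne', abs_of_pos (inv_pos.2 hL), Measure.restrict_smul]

lemma measurePreserving_circleLift {L : ℝ} (hL : 0 < L) :
    MeasurePreserving (circleLift L) AddCircle.haarAddCircle
      (ENNReal.ofReal L⁻¹ • volume.restrict (Ioo 0 L)) := by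
  rw [restrict_Ioo_eq_restrict_Ioc]
  exact (measurePreserving_mul_left_Ioc hL).comp measurePreserving_coe_equivIoc

lemma hasFDerivAt_cexp_ofReal_mul_I {E : Type*} [NormedAddCommGroup E] [NormedSpace ℝ E]
    (f : E →L[ℝ] ℝ) (x : E) :
    HasFDerivAt (fun x => Complex.exp (f x * Complex.I))
      (Complex.exp (f x * Complex.I) • f.smulRight Complex.I) x := by
  have h : HasFDerivAt (fun x => (f x * Complex.I : ℂ)) (f.smulRight Complex.I) x :=
    (f.smulRight Complex.I).hasFDerivAt.congr_of_eventuallyEq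
      (.of_forall fun y => (Complex.real_smul (x := f y)).symm)
  exact h.cexp

lemma le_sq_two_pi_mul_div {L C k : ℝ} (hL : 0 < L) (hk : L * max C 1 ≤ |k|) :
    C ≤ (2 * Real.pi * k / L) ^ 2 := by
  have hmax : max C 1 ≤ |2 * Real.pi * k / L| := by
    rw [abs_div, abs_mul, abs_of_pos hL, abs_of_pos Real.two_pi_pos, le_div_iff₀ hL]
    nlinarith [Real.pi_gt_three, abs_nonneg k]
  calc C ≤ max C 1 := le_max_left C 1
    _ ≤ |2 * Real.pi * k / L| := hmax
    _ ≤ |2 * Real.pi * k / L| ^ 2 := le_self_pow₀ ((le_max_right C 1).trans hmax) two_ne_zero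
    _ = (2 * Real.pi * k / L) ^ 2 := sq_abs _

namespace PeriodicMedium

variable (M : PeriodicMedium)

/-- The lift of the unit torus to the half-open cell `(0, ℓ] × (0, d]`. -/
def torusLift (x : UnitAddTorus (Fin 2)) : ℝ × ℝ :=
  (circleLift M.ℓ (x 0), circleLift M.d (x 1))

lemma measurePreserving_torusLift :
    MeasurePreserving M.torusLift (Measure.pi fun _ => AddCircle.haarAddCircle)
      (ENNReal.ofReal (M.ℓ * M.d)⁻¹ • volume.restrict M.Y) := by
  have h := ((measurePreserving_circleLift M.ℓ_pos).prod
    (measurePreserving_circleLift M.d_pos)).comp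
    (measurePreserving_piFinTwo fun _ : Fin 2 => AddCircle.haarAddCircle (T := 1))
  rwa [Measure.prod_smul_left, Measure.prod_smul_right, smul_smul, ← M.measure_Y,
    ← ENNReal.ofReal_mul (inv_pos.2 M.ℓ_pos).le, ← mul_inv] at h

lemma area_pos : 0 < M.ℓ * M.d := mul_pos M.ℓ_pos M.d_pos

/-- The wave vector `(2π n₀ / ℓ, 2π n₁ / d)` of the `n`-th periodic exponential, as a linear
form. -/
def frequency (n : Fin 2 → ℤ) : ℝ × ℝ →L[ℝ] ℝ :=
  (2 * Real.pi * n 0 / M.ℓ) • ContinuousLinearMap.fst ℝ ℝ ℝ +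
    (2 * Real.pi * n 1 / M.d) • ContinuousLinearMap.snd ℝ ℝ ℝ

lemma frequency_apply (n : Fin 2 → ℤ) (ξ : ℝ × ℝ) :
    M.frequency n ξ = 2 * Real.pi * n 0 / M.ℓ * ξ.1 + 2 * Real.pi * n 1 / M.d * ξ.2 := rfl

lemma frequency_neg (n : Fin 2 → ℤ) : M.frequency (-n) = -M.frequency n := by
  ext <;> simp [frequency] <;> ring

/-- The periodic exponential `exp (2πi (n₀ ξ₁ / ℓ + n₁ ξ₂ / d))`. -/
def character (n : Fin 2 → ℤ) (ξ : ℝ × ℝ) : ℂ :=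
  Complex.exp (M.frequency n ξ * Complex.I)

lemma contDiff_character (n : Fin 2 → ℤ) : ContDiff ℝ (⊤ : ℕ∞) (M.character n) :=
  ((Complex.ofRealCLM.contDiff.comp (M.frequency n).contDiff).mul contDiff_const).cexp

lemma continuous_character (n : Fin 2 → ℤ) : Continuous (M.character n) :=
  (M.contDiff_character n).continuous

lemma fderiv_character (n : Fin 2 → ℤ) (ξ e : ℝ × ℝ) :
    fderiv ℝ (M.character n) ξ e = M.frequency n e * Complex.I * M.character n ξ := by
  have h : HasFDerivAt (M.character n) _ ξ := hasFDerivAt_cexp_ofReal_mul_I (M.frequency n) ξ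
  rw [h.fderiv, _root_.smul_apply, ContinuousLinearMap.smulRight_apply, Complex.real_smul,
    smul_eq_mul, mul_comm, character]

lemma conj_character (n : Fin 2 → ℤ) (ξ : ℝ × ℝ) :
    conj (M.character n ξ) = M.character (-n) ξ := by
  rw [character, character, ← Complex.exp_conj, frequency_neg, map_mul, Complex.conj_ofReal,
    Complex.conj_I, _root_.neg_apply, Complex.ofReal_neg, mul_neg, neg_mul]

lemma character_add_eq_self {n : Fin 2 → ℤ} {e : ℝ × ℝ} {k : ℤ}
    (he : M.frequency n e = k * (2 * Real.pi)) (ξ : ℝ × ℝ) :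
    M.character n (ξ + e) = M.character n ξ := by
  rw [character, character, Complex.exp_eq_exp_iff_exists_int]
  refine ⟨k, ?_⟩
  rw [map_add, he]
  push_cast
  ring

lemma character_length_left (n : Fin 2 → ℤ) (y : ℝ) :
    M.character n (M.ℓ, y) = M.character n (0, y) := by
  have he : M.frequency n (M.ℓ, 0) = n 0 * (2 * Real.pi) := by
    rw [frequency_apply, mul_zero, add_zero, div_mul_cancel₀ _ M.ℓ_pos.ne', mul_comm]
  simpa using M.character_add_eq_self he (0, y)

lemma character_length_right (n : Fin 2 → ℤ) (x : ℝ) :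
    M.character n (x, M.d) = M.character n (x, 0) := by
  have he : M.frequency n (0, M.d) = n 1 * (2 * Real.pi) := by
    rw [frequency_apply, mul_zero, zero_add, div_mul_cancel₀ _ M.d_pos.ne', mul_comm]
  simpa using M.character_add_eq_self he (x, 0)

lemma character_torusLift (n : Fin 2 → ℤ) (x : UnitAddTorus (Fin 2)) :
    M.character n (M.torusLift x) = UnitAddTorus.mFourier n x := by
  simp only [UnitAddTorus.mFourier, ContinuousMap.coe_mk, Fin.prod_univ_two]
  conv_rhs => rw [← coe_circleLift_div M.ℓ_pos.ne' (x 0), ← coe_circleLift_div M.d_pos.ne' (x 1)]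
  rw [fourier_coe_apply, fourier_coe_apply, ← Complex.exp_add, character, torusLift,
    frequency_apply]
  congr 1
  push_cast
  ring

/-- The periodic exponential normalised in `L²(Y)`. -/
def fourierMode (n : Fin 2 → ℤ) : M.L2Y :=
  (√(M.ℓ * M.d) : ℂ)⁻¹ • (M.memLp_Y (M.continuous_character n)).toLp (M.character n)

lemma coeFn_fourierMode (n : Fin 2 → ℤ) :
    M.fourierMode n =ᵐ[volume.restrict M.Y]
      fun ξ => (√(M.ℓ * M.d) : ℂ)⁻¹ * M.character n ξ := by
  have hχ := M.memLp_Y (M.continuous_character n)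
  filter_upwards [Lp.coeFn_smul (√(M.ℓ * M.d) : ℂ)⁻¹ (hχ.toLp _), hχ.coeFn_toLp]
    with ξ hsmul hξ
  rw [fourierMode, hsmul, Pi.smul_apply, hξ, smul_eq_mul]

lemma inner_fourierMode (n : Fin 2 → ℤ) (g : M.L2Y) :
    inner ℂ (M.fourierMode n) g =
      (√(M.ℓ * M.d) : ℂ)⁻¹ * ∫ ξ in M.Y, g ξ * M.character (-n) ξ := by
  rw [L2.inner_def, ← integral_const_mul]
  refine integral_congr_ae ?_
  filter_upwards [M.coeFn_fourierMode n] with ξ hξ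
  rw [hξ, RCLike.inner_apply, map_mul, conj_character, map_inv₀, Complex.conj_ofReal]
  ring

lemma rescaledPullback_fourierMode (n : Fin 2 → ℤ) :
    rescaledPullback M.measurePreserving_torusLift (M.fourierMode n) =
      UnitAddTorus.mFourierBasis n := by
  have hsqrt : (√(M.ℓ * M.d) : ℂ) ≠ 0 := by exact_mod_cast (Real.sqrt_pos.2 M.area_pos).ne'
  have hmode : M.fourierMode n =ᵐ[ENNReal.ofReal (M.ℓ * M.d)⁻¹ • volume.restrict M.Y] _ :=
    Measure.smul_absolutelyContinuous.ae_le (M.coeFn_fourierMode n)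
  rw [UnitAddTorus.coe_mFourierBasis]
  refine Lp.ext ?_
  filter_upwards [coeFn_rescaledPullback M.measurePreserving_torusLift (M.fourierMode n),
    M.measurePreserving_torusLift.quasiMeasurePreserving.ae_eq_comp hmode,
    UnitAddTorus.coeFn_mFourierLp 2 n] with x hpull hx hfourier
  rw [Function.comp_apply, Function.comp_apply] at hx
  rw [hpull, hfourier, hx, character_torusLift, mul_inv_cancel_left₀ hsqrt]

lemma orthonormal_fourierMode : Orthonormal ℂ M.fourierMode := by
  rw [orthonormal_iff_ite]
  intro m n
  rw [← inner_rescaledPullback M.area_pos M.measurePreserving_torusLift,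
    rescaledPullback_fourierMode, rescaledPullback_fourierMode]
  exact orthonormal_iff_ite.1 UnitAddTorus.mFourierBasis.orthonormal m n

lemma span_fourierMode_orthogonal : (Submodule.span ℂ (range M.fourierMode))ᗮ = ⊥ := by
  refine (Submodule.eq_bot_iff _).2 fun g hg => ?_
  set f := rescaledPullback M.measurePreserving_torusLift g with hf
  have hcoeff : ∀ n, inner ℂ (UnitAddTorus.mFourierBasis n) f = 0 := fun n => by
    rw [← rescaledPullback_fourierMode, hf,
      inner_rescaledPullback M.area_pos M.measurePreserving_torusLift]
    exact (Submodule.mem_orthogonal _ _).1 hg _ (Submodule.subset_span ⟨n, rfl⟩)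
  have hf0 : f = 0 := UnitAddTorus.mFourierBasis.repr.injective <| by
    ext n
    rw [HilbertBasis.repr_apply_apply, hcoeff, map_zero]
    rfl
  rw [← inner_self_eq_zero (𝕜 := ℂ),
    ← inner_rescaledPullback M.area_pos M.measurePreserving_torusLift, ← hf, hf0,
    inner_zero_left]

/-- The orthonormal basis of `L²(Y)` formed by the periodic exponentials. -/
def fourierBasis : HilbertBasis (Fin 2 → ℤ) ℂ M.L2Y :=
  HilbertBasis.mkOfOrthogonalEqBot M.orthonormal_fourierMode M.span_fourierMode_orthogonal

lemma fourierBasis_apply (n : Fin 2 → ℤ) : M.fourierBasis n = M.fourierMode n :=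
  congrFun (HilbertBasis.coe_mkOfOrthogonalEqBot _ _) n

/-! ### The Rellich theorem for periodic functions -/

/-- The bounded operators `φ ↦ φ, ∂φ/∂ξ₁, ∂φ/∂ξ₂` from `H¹_p(Y)` to `L²(Y)`, indexed by
`i = 0, 1, 2`. -/
def component (i : Fin 3) : M.H1p →L[ℂ] M.L2Y :=
  (PiLp.proj 2 (fun _ : Fin 3 => M.L2Y) i : _ →L[ℂ] M.L2Y) ∘L M.H1p.subtypeL

lemma inner_fourierBasis_of_integral_eq_zero {g gₑ : M.L2Y} {e : ℝ × ℝ} {n : Fin 2 → ℤ}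
    (h : ∫ ξ in M.Y, (g ξ * fderiv ℝ (M.character (-n)) ξ e + gₑ ξ * M.character (-n) ξ) = 0) :
    inner ℂ (M.fourierBasis n) gₑ =
      M.frequency n e * Complex.I * inner ℂ (M.fourierBasis n) g := by
  have hχ := M.contDiff_character (-n)
  rw [integral_add (integrable_mul (Lp.memLp _) (M.memLp_Y (cont_fderiv hχ _)))
    (integrable_mul (Lp.memLp _) (M.memLp_Y hχ.continuous))] at h
  simp only [fderiv_character, mul_left_comm _ (_ * Complex.I), integral_const_mul, frequency_neg,
    _root_.neg_apply, Complex.ofReal_neg] at h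
  rw [fourierBasis_apply, inner_fourierMode, inner_fourierMode]
  linear_combination (√(M.ℓ * M.d) : ℂ)⁻¹ * h

lemma inner_fourierBasis_component_one (φ : M.H1p) (n : Fin 2 → ℤ) :
    inner ℂ (M.fourierBasis n) (M.component 1 φ) =
      M.frequency n (1, 0) * Complex.I * inner ℂ (M.fourierBasis n) (M.component 0 φ) := by
  obtain ⟨-, -, ⟨t, ht⟩, -⟩ := φ.2
  refine M.inner_fourierBasis_of_integral_eq_zero ((ht _ (M.contDiff_character (-n))).trans ?_)
  simp only [character_length_left, sub_self, integral_zero]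

lemma inner_fourierBasis_component_two (φ : M.H1p) (n : Fin 2 → ℤ) :
    inner ℂ (M.fourierBasis n) (M.component 2 φ) =
      M.frequency n (0, 1) * Complex.I * inner ℂ (M.fourierBasis n) (M.component 0 φ) := by
  obtain ⟨-, -, -, ⟨t, ht⟩⟩ := φ.2
  refine M.inner_fourierBasis_of_integral_eq_zero ((ht _ (M.contDiff_character (-n))).trans ?_)
  simp only [character_length_right, sub_self, integral_zero]

lemma sum_sq_norm_inner_fourierBasis_component_succ (φ : M.H1p) (n : Fin 2 → ℤ) :
    ∑ j : Fin 2, ‖inner ℂ (M.fourierBasis n) (M.component j.succ φ)‖ ^ 2 =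
      (M.frequency n (1, 0) ^ 2 + M.frequency n (0, 1) ^ 2) *
        ‖inner ℂ (M.fourierBasis n) (M.component 0 φ)‖ ^ 2 := by
  rw [Fin.sum_univ_two, Fin.succ_zero_eq_one, Fin.succ_one_eq_two,
    inner_fourierBasis_component_one, inner_fourierBasis_component_two]
  simp only [norm_mul, Complex.norm_I, Complex.norm_real, Real.norm_eq_abs, mul_one, mul_pow,
    sq_abs, add_mul]

lemma exists_finset_forall_notMem_le_sq_frequency (C : ℝ) : ∃ s : Finset (Fin 2 → ℤ),
    ∀ n ∉ s, C ≤ M.frequency n (1, 0) ^ 2 + M.frequency n (0, 1) ^ 2 := by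
  obtain ⟨N, hN⟩ := exists_nat_ge (max (M.ℓ * max C 1) (M.d * max C 1))
  obtain ⟨hNℓ, hNd⟩ := max_le_iff.1 hN
  refine ⟨Fintype.piFinset fun _ => Finset.Icc (-N : ℤ) N, fun n hn => ?_⟩
  simp only [frequency_apply, mul_one, mul_zero, add_zero, zero_add]
  have hlarge : ∀ i, (N : ℤ) < |n i| → (N : ℝ) ≤ |(n i : ℝ)| := fun i hi => by exact_mod_cast hi.le
  simp only [Fintype.mem_piFinset, Finset.mem_Icc, ← abs_le, Fin.forall_fin_two, not_and_or,
    not_le] at hn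
  rcases hn with hn | hn
  · exact (le_sq_two_pi_mul_div M.ℓ_pos (hNℓ.trans (hlarge 0 hn))).trans
      (le_add_of_nonneg_right (sq_nonneg _))
  · exact (le_sq_two_pi_mul_div M.d_pos (hNd.trans (hlarge 1 hn))).trans
      (le_add_of_nonneg_left (sq_nonneg _))

lemma isCompactOperator_component_zero : IsCompactOperator (M.component 0) := by
  refine isCompactOperator_of_sq_norm_inner_le M.fourierBasis _
    (fun j : Fin 2 => M.component j.succ) fun ε hε => ?_
  obtain ⟨s, hs⟩ := M.exists_finset_forall_notMem_le_sq_frequency ε⁻¹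
  refine ⟨s, fun n hn φ => ?_⟩
  rw [sum_sq_norm_inner_fourierBasis_component_succ, ← mul_assoc]
  exact le_mul_of_one_le_left (sq_nonneg _) ((inv_le_iff_one_le_mul₀' hε).1 (hs n hn))

/-! ### The operator pencil -/

/-- The bounded operator on `H¹_p(Y)` representing the form `∫ a ∂ᵢφ ∂ⱼψ̄`, where `∂₀` is the
identity. -/
def weightedOp {a : ℝ × ℝ → ℂ} (ha : MemLp a ⊤ (volume.restrict M.Y)) (i j : Fin 3) :
    M.H1p →L[ℂ] M.H1p :=
  (M.component j).adjoint ∘L mulLp ha ∘L M.component i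

section WeightedOp

variable {M} {a : ℝ × ℝ → ℂ} (ha : MemLp a ⊤ (volume.restrict M.Y))

lemma inner_weightedOp_eq_inner_mulLp (i j : Fin 3) (φ ψ : M.H1p) :
    inner ℂ ψ (M.weightedOp ha i j φ) =
      inner ℂ (M.component j ψ) (mulLp ha (M.component i φ)) := by
  simp only [weightedOp, ContinuousLinearMap.comp_apply]
  rw [ContinuousLinearMap.adjoint_inner_right]

lemma inner_weightedOp (i j : Fin 3) (φ ψ : M.H1p) :
    inner ℂ ψ (M.weightedOp ha i j φ) = ∫ ξ in M.Y, a ξ * (φ.1 i ξ * conj (ψ.1 j ξ)) :=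
  (inner_weightedOp_eq_inner_mulLp ha i j φ ψ).trans (inner_mulLp ha _ _)

lemma adjoint_weightedOp_ofReal {a : ℝ × ℝ → ℝ}
    (ha : MemLp (fun ξ => (a ξ : ℂ)) ⊤ (volume.restrict M.Y)) (i j : Fin 3) :
    (M.weightedOp ha i j).adjoint = M.weightedOp ha j i := by
  simp only [weightedOp, ContinuousLinearMap.adjoint_comp, ContinuousLinearMap.adjoint_adjoint,
    adjoint_mulLp_ofReal, ContinuousLinearMap.comp_assoc]

lemma isCompactOperator_weightedOp_zero_left (j : Fin 3) :
    IsCompactOperator (M.weightedOp ha 0 j) :=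
  M.isCompactOperator_component_zero.clm_comp ((M.component j).adjoint ∘L mulLp ha)

lemma isCompactOperator_weightedOp_zero_right (i : Fin 3) :
    IsCompactOperator (M.weightedOp ha i 0) :=
  (isCompactOperator_adjoint M.isCompactOperator_component_zero).comp_clm
    (mulLp ha ∘L M.component i)

end WeightedOp

lemma opC_eq_weightedOp : M.opC = M.weightedOp M.memLp_G 0 0 := by
  ext1 φ
  refine ext_inner_left ℂ fun ψ => ?_
  simp only [inner_opC, formC, inner_weightedOp, fn, mul_assoc]

lemma opB_eq_weightedOp : M.opB =
    -Complex.I • (M.weightedOp M.memLp_G 1 0 - M.weightedOp M.memLp_G 0 1) := by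
  ext1 φ
  refine ext_inner_left ℂ fun ψ => ?_
  have hint := M.integrable_form M.memLp_G
  rw [_root_.smul_apply, inner_smul_right, _root_.sub_apply, inner_sub_right, inner_weightedOp,
    inner_weightedOp, inner_opB, formB, ← integral_sub (hint _ _) (hint _ _)]
  simp only [fn, d1, mul_sub]

lemma opA_eq_weightedOp (ω k₂ : ℝ) : M.opA ω k₂ =
    (k₂ : ℂ) ^ 2 • M.weightedOp M.memLp_G 0 0
      - ((k₂ : ℂ) * Complex.I) • (M.weightedOp M.memLp_G 2 0 - M.weightedOp M.memLp_G 0 2)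
      - (ω : ℂ) ^ 2 • M.weightedOp M.memLp_ρ 0 0
      + (M.weightedOp M.memLp_G 1 1 + M.weightedOp M.memLp_G 2 2) := by
  ext1 φ
  refine ext_inner_left ℂ fun ψ => ?_
  have hint := M.integrable_form M.memLp_G
  have hsmul (c : ℂ) (T : M.H1p →L[ℂ] M.H1p) : inner ℂ ψ ((c • T) φ) = c * inner ℂ ψ (T φ) := by
    rw [_root_.smul_apply, inner_smul_right]
  simp only [_root_.add_apply, _root_.sub_apply, inner_add_right, inner_sub_right, hsmul,
    inner_weightedOp, inner_opA, formA]
  rw [← integral_sub (hint _ _) (hint _ _), ← integral_add (hint _ _) (hint _ _)]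
  simp only [fn, d1, d2, mul_sub, mul_add, mul_assoc]

lemma adjoint_opC : M.opC.adjoint = M.opC := by
  rw [opC_eq_weightedOp, adjoint_weightedOp_ofReal]

lemma adjoint_opB : M.opB.adjoint = M.opB := by
  simp only [opB_eq_weightedOp, ← ContinuousLinearMap.star_eq_adjoint, star_smul, star_sub]
  simp only [ContinuousLinearMap.star_eq_adjoint, adjoint_weightedOp_ofReal, star_neg,
    RCLike.star_def, Complex.conj_I]
  module

lemma adjoint_opA (ω k₂ : ℝ) : (M.opA ω k₂).adjoint = M.opA ω k₂ := by
  simp only [opA_eq_weightedOp, ← ContinuousLinearMap.star_eq_adjoint, star_smul, star_sub,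
    star_add]
  simp only [ContinuousLinearMap.star_eq_adjoint, adjoint_weightedOp_ofReal, RCLike.star_def,
    map_mul, map_pow, Complex.conj_I, Complex.conj_ofReal]
  module

lemma adjoint_pencil (ω k₂ : ℝ) (z : ℂ) :
    (M.pencil ω k₂ z).adjoint = M.pencil ω k₂ (conj z) := by
  simp only [pencil, map_add, map_smulₛₗ, map_pow, adjoint_opA, adjoint_opB, adjoint_opC]

/-- The operator representing the coercive form `∫ G (φ ψ̄ + ∇φ · ∇ψ̄)`. -/
def energyOp : M.H1p →L[ℂ] M.H1p := ∑ i, M.weightedOp M.memLp_G i i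

lemma sq_norm_eq_sum_sq_norm_component (φ : M.H1p) : ‖φ‖ ^ 2 = ∑ i, ‖M.component i φ‖ ^ 2 :=
  PiLp.norm_sq_eq_of_L2 _ _

lemma mul_sq_norm_le_re_inner_energyOp (φ : M.H1p) :
    M.Ginf * ‖φ‖ ^ 2 ≤ RCLike.re (inner ℂ φ (M.energyOp φ)) := by
  have hG : ∀ᵐ ξ ∂volume.restrict M.Y, M.Ginf ≤ M.G ξ := M.G_bound.mono fun _ h => h.1
  rw [energyOp, _root_.sum_apply, inner_sum, map_sum,
    sq_norm_eq_sum_sq_norm_component, Finset.mul_sum]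
  refine Finset.sum_le_sum fun i _ => ?_
  rw [inner_weightedOp_eq_inner_mulLp]
  exact mul_sq_norm_le_re_inner_mulLp M.memLp_G hG _

lemma isUnit_energyOp : IsUnit M.energyOp := by
  refine ContinuousLinearMap.isUnit_of_forall_le_norm_inner_map _
    (c := ⟨M.Ginf, M.Ginf_pos.le⟩) M.Ginf_pos fun φ => ?_
  rw [← norm_inner_symm, mul_comm]
  exact (M.mul_sq_norm_le_re_inner_energyOp φ).trans (RCLike.re_le_norm _)

lemma isCompactOperator_pencil_sub_energyOp (ω k₂ : ℝ) (z : ℂ) :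
    IsCompactOperator (M.pencil ω k₂ z - M.energyOp) := by
  let 𝒦 := compactOperator (RingHom.id ℂ) M.H1p M.H1p
  have hleft : ∀ j, M.weightedOp M.memLp_G 0 j ∈ 𝒦 :=
    isCompactOperator_weightedOp_zero_left M.memLp_G
  have hright : ∀ i, M.weightedOp M.memLp_G i 0 ∈ 𝒦 :=
    isCompactOperator_weightedOp_zero_right M.memLp_G
  have hρ : M.weightedOp M.memLp_ρ 0 0 ∈ 𝒦 := isCompactOperator_weightedOp_zero_left M.memLp_ρ 0
  have hB : M.opB ∈ 𝒦 := by
    rw [opB_eq_weightedOp]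
    exact 𝒦.smul_mem _ (𝒦.sub_mem (hright 1) (hleft 1))
  have hC : M.opC ∈ 𝒦 := by
    rw [opC_eq_weightedOp]
    exact hleft 0
  have hA : M.opA ω k₂ - M.energyOp ∈ 𝒦 := by
    have hsplit : M.opA ω k₂ - M.energyOp = ((k₂ : ℂ) ^ 2 - 1) • M.weightedOp M.memLp_G 0 0
        - ((k₂ : ℂ) * Complex.I) • (M.weightedOp M.memLp_G 2 0 - M.weightedOp M.memLp_G 0 2)
        - (ω : ℂ) ^ 2 • M.weightedOp M.memLp_ρ 0 0 := by
      rw [opA_eq_weightedOp, energyOp, Fin.sum_univ_three]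
      module
    rw [hsplit]
    exact 𝒦.sub_mem (𝒦.sub_mem (𝒦.smul_mem _ (hleft 0))
      (𝒦.smul_mem _ (𝒦.sub_mem (hright 2) (hleft 2)))) (𝒦.smul_mem _ hρ)
  have hsum : M.pencil ω k₂ z - M.energyOp =
      M.opA ω k₂ - M.energyOp + z • M.opB + z ^ 2 • M.opC := by
    rw [pencil]
    module
  rw [hsum]
  exact 𝒦.add_mem (𝒦.add_mem hA (𝒦.smul_mem _ hB)) (𝒦.smul_mem _ hC)

lemma exists_pencil_conj_eq_zero (ω k₂ : ℝ) (z : ℂ)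
    (h : ∃ φ : M.H1p, φ ≠ 0 ∧ M.pencil ω k₂ z φ = 0) :
    ∃ ψ : M.H1p, ψ ≠ 0 ∧ M.pencil ω k₂ (conj z) ψ = 0 := by
  have hsum : M.energyOp + (M.pencil ω k₂ z - M.energyOp) = M.pencil ω k₂ z :=
    add_sub_cancel _ _
  rw [← adjoint_pencil, ← hsum]
  rw [← hsum] at h
  exact exists_ne_zero_adjoint_add_apply_eq_zero M.isUnit_energyOp
    (M.isCompactOperator_pencil_sub_energyOp ω k₂ z) h

lemma isEigenvalue_iff_exists_pencil_eq_zero (ω k₂ : ℝ) (κ : ℂ) :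
    M.IsEigenvalue ω k₂ κ ↔ ∃ φ : M.H1p, φ ≠ 0 ∧ M.pencil ω k₂ κ φ = 0 := by
  refine exists_congr fun φ => and_congr_right fun _ => ?_
  rw [ext_iff_inner_left ℂ]
  refine forall_congr' fun ψ => ?_
  rw [inner_zero_right, pencil, _root_.add_apply, _root_.add_apply, _root_.smul_apply,
    _root_.smul_apply, inner_add_right, inner_add_right, inner_smul_right, inner_smul_right,
    inner_opA, inner_opB, inner_opC, formA, formB, formC]
  refine Eq.congr ?_ rfl
  ring

end PeriodicMedium

end

theorem proposition1 (M : PeriodicMedium) (ω k₂ : ℝ) (hω : 0 < ω) :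
    (∀ z : ℂ, (∃ φ : M.H1p, φ ≠ 0 ∧ M.pencil ω k₂ z φ = 0) →
      ∃ ψ : M.H1p, ψ ≠ 0 ∧ M.pencil ω k₂ (starRingEnd ℂ z) ψ = 0) ∧
    (∀ κ : ℂ, M.IsEigenvalue ω k₂ κ ↔ M.IsEigenvalue ω k₂ (starRingEnd ℂ κ)) := by
  refine ⟨M.exists_pencil_conj_eq_zero ω k₂, fun κ => ?_⟩
  simp only [PeriodicMedium.isEigenvalue_iff_exists_pencil_eq_zero]
  refine ⟨M.exists_pencil_conj_eq_zero ω k₂ κ, fun h => ?_⟩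
  simpa using M.exists_pencil_conj_eq_zero ω k₂ _ h
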